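/- Lemma 3.6 (Posterior concentration). Let $\theta_0$ be a probability mass function on $\{1,2,\dots\}$, let $(k_n)$ be a non-decreasing sequence of positive integers and $(M_n)$ a sequence of reals increasing to $+\infty$. Write $\theta_0$ also for its truncation at level $k_n$, the p.m.f. on $\{0,\dots,k_n\}$ with $\theta_0(0)=\sum_{i>k_n}\theta_0(i)$. Let $\Theta_{k}$ be the set of p.m.f.s on $\{0,\dots,k\}$. Let $\mathbb P_{n,0}$ be the law on $\{0,\dots,k_n\}^n$ of an i.i.d. sample of size $n$ from the truncated $\theta_0$. Let $W_n$ be a prior probability distribution on $\Theta_{k_n}$ under which $(\theta(1),\dots,\theta(k_n))$ has density $w_n\ge 0$ with respect to Lebesgue measure on $\mathbb R^{k_n}$. Let $\tau\sim W_n$ and, given $\tau$, let $X_{1:n}=(X_1,\dots,X_n)$ be i.i.d. with p.m.f. $\tau$. Put $H_n=\sqrt n\,(\tau(i)-\theta_0(i))_{1\le i\le k_n}$, identified with the vector of $\mathbb R^{k_n+1}$ with index set $0\le i\le k_n$ defined by the same formula, and let $P_{H_n|X_{1:n}}$ be the posterior distribution of $H_n$, i.e. its conditional distribution given $X_{1:n}$.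 Let $$I(\theta_0)=\mathrm{Diag}\Big(\frac1{\theta_0(i)}\Big)_{1\le i\le k_n}+\frac1{\theta_0(0)}\mathbf 1\mathbf 1^T,\qquad \sigma_n^2(h)=\sum_{i=0}^{k_n}\frac{h(i)^2}{\theta_0(i)}\quad(0/0=0),$$ $$\mathcal E_{\theta_0,k_n}(M)=\Big\{h\in\mathbb R^{k_n+1}:\ \sigma_n^2(h)\le M,\ \sum_{i=0}^{k_n}h(i)=0,\ h(i)\ge-\sqrt n\,\theta_0(i)\ (0\le i\le k_n)\Big\}.$$ Here $w_n(\theta_0+h/\sqrt n)$ is $w_n$ evaluated at the coordinates $1,\dots,k_n$. Assume that, as $n\to\infty$, - (Condition 2.1) $n\inf_{0\le i\le k_n}\theta_0(i)\to+\infty$; - (Condition 3.4, prior smoothness) $\displaystyle\sup_{h,g\in\mathcal E_{\theta_0,k_n}(M_n)}\frac{w_n(\theta_0+h/\sqrt n)}{w_n(\theta_0+g/\sqrt n)}\to1$, the ratio being $+\infty$ where only its denominator vanishes; - (Condition 3.5, prior concentration) $\displaystyle\frac{k_n}2\log n\ \vee\ \log\det I(\theta_0)\ \vee\ -\log w_n(\theta_0)=o(M_n)$,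 where $-\log 0=+\infty$ (so $w_n(\theta_0)>0$ for all large $n$); - $M_n=o\big(n\inf_{0\le i\le k_n}\theta_0(i)\big)$. Then, for all sufficiently large $n$, $$\mathbb P_{n,0}\,P_{H_n|X_{1:n}}\big(H_n^TI(\theta_0)H_n\ge M_n\big)=\mathbb P_{n,0}\,P_{H_n|X_{1:n}}\big(H_n\notin\mathcal E_{\theta_0,k_n}(M_n)\big),$$ where $\mathbb P_{n,0}$ applied to a random variable denotes its expectation, and this quantity tends to $0$ as $n\to\infty$. -/

import Mathlib

open MeasureTheory ProbabilityTheory Filter Asymptotics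
open scoped Topology ENNReal NNReal Matrix

namespace PosteriorConcentration

/-- Truncation at level `k` of an observation `x ∈ {1, 2, …}`: it is kept if `x ≤ k` and replaced
by `0` otherwise. -/
def trunc (k : ℕ) (x : ℕ+) : Fin (k + 1) :=
  if h : (x : ℕ) ≤ k then ⟨x, Nat.lt_succ_of_le h⟩ else 0

/-- The image of a p.m.f. on `{1, 2, …}` by truncation at level `k`, as a point of `Θ_k`, the set
of p.m.f.s on `{0, …, k}`. -/
noncomputable def truncPmf (θ₀ : PMF ℕ+) (k : ℕ) : stdSimplex ℝ (Fin (k + 1)) :=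
  ⟨fun i => ((θ₀.map (trunc k)) i).toReal, fun _ => ENNReal.toReal_nonneg, by
    rw [← ENNReal.toReal_sum fun i _ => PMF.apply_ne_top _ i, ← tsum_fintype (L := .unconditional _),
      PMF.tsum_coe, ENNReal.toReal_one]⟩

/-- The probability measure on `{0, …, k}` with p.m.f. `θ`. -/
noncomputable def pmfMeasure {k : ℕ} (θ : stdSimplex ℝ (Fin (k + 1))) : Measure (Fin (k + 1)) :=
  ∑ i, ENNReal.ofReal (θ i) • Measure.dirac i

instance {k : ℕ} (θ : stdSimplex ℝ (Fin (k + 1))) : IsProbabilityMeasure (pmfMeasure θ) := by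
  constructor
  simp only [pmfMeasure, Measure.coe_finsetSum, Finset.sum_apply, Measure.smul_apply,
    measure_univ, smul_eq_mul, mul_one]
  have h := ENNReal.ofReal_sum_of_nonneg (s := Finset.univ) (f := fun i => θ i)
    fun i _ => θ.2.1 i
  exact h.symm.trans ((congrArg ENNReal.ofReal θ.2.2).trans ENNReal.ofReal_one)

/-- The law on `{0, …, k}ⁿ` of an i.i.d. sample of size `n` from `θ`. -/
noncomputable def sampleLaw (n : ℕ) {k : ℕ} (θ : stdSimplex ℝ (Fin (k + 1))) :
    Measure (Fin n → Fin (k + 1)) :=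
  Measure.pi fun _ => pmfMeasure θ

instance (n : ℕ) {k : ℕ} (θ : stdSimplex ℝ (Fin (k + 1))) :
    IsProbabilityMeasure (sampleLaw n θ) := by
  unfold sampleLaw; infer_instance

theorem pmfMeasure_singleton {k : ℕ} (θ : stdSimplex ℝ (Fin (k + 1))) (j : Fin (k + 1)) :
    pmfMeasure θ {j} = ENNReal.ofReal (θ j) := by
  simp [pmfMeasure, Set.indicator_apply]

theorem sampleLaw_singleton (n : ℕ) {k : ℕ} (θ : stdSimplex ℝ (Fin (k + 1)))
    (x : Fin n → Fin (k + 1)) : sampleLaw n θ {x} = ∏ j, ENNReal.ofReal (θ (x j)) := by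
  simp [sampleLaw, pmfMeasure_singleton]

theorem measurable_sampleLaw (n k : ℕ) :
    Measurable fun θ : stdSimplex ℝ (Fin (k + 1)) => sampleLaw n θ := by
  refine Measure.measurable_of_measurable_coe _ fun s _ => ?_
  have h : (fun θ : stdSimplex ℝ (Fin (k + 1)) => sampleLaw n θ s) =
      fun θ => ∑ x ∈ s.toFinite.toFinset, ∏ j, ENNReal.ofReal (θ (x j)) := by
    funext θ
    simp_rw [← sampleLaw_singleton]
    rw [sum_measure_singleton, Set.Finite.coe_toFinset]
  rw [h]
  refine Finset.measurable_sum _ fun x _ => Finset.measurable_prod _ fun j _ => ?_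
  exact ((measurable_pi_apply (x j)).comp measurable_subtype_coe).ennreal_ofReal

/-- The statistical model: conditionally on the parameter `θ ∈ Θ_k`, the sample
`X_{1:n} ∈ {0, …, k}ⁿ` is i.i.d. with p.m.f. `θ`. -/
noncomputable def model (n k : ℕ) :
    Kernel (stdSimplex ℝ (Fin (k + 1))) (Fin n → Fin (k + 1)) where
  toFun θ := sampleLaw n θ
  measurable' := measurable_sampleLaw n k

instance (n k : ℕ) : IsMarkovKernel (model n k) :=
  ⟨fun θ => inferInstanceAs (IsProbabilityMeasure (sampleLaw n θ))⟩

/-- The smallest cell probability `inf_{0 ≤ i ≤ k} θ(i)`. -/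
noncomputable def minProb {k : ℕ} (θ : stdSimplex ℝ (Fin (k + 1))) : ℝ := ⨅ i, θ i

/-- The `k × k` Fisher information matrix
`I(θ) = Diag(1/θ(1), …, 1/θ(k)) + (1/θ(0)) 𝟏𝟏ᵀ`. -/
noncomputable def fisherInfo {k : ℕ} (θ : stdSimplex ℝ (Fin (k + 1))) :
    Matrix (Fin k) (Fin k) ℝ :=
  Matrix.diagonal (fun i => 1 / θ i.succ) + Matrix.of fun _ _ => 1 / θ 0

/-- `σ_n²(h) = ∑_{i=0}^k h(i)² / θ₀(i)`. -/
noncomputable def sigmaSq {k : ℕ} (θ : stdSimplex ℝ (Fin (k + 1))) (h : Fin (k + 1) → ℝ) : ℝ :=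
  ∑ i, h i ^ 2 / θ i

/-- The set `ℰ_{θ₀,k}(M)` of the `h ∈ ℝ^{k+1}` with `σ_n²(h) ≤ M`, `∑ h(i) = 0` and
`h(i) ≥ -√n θ₀(i)`. As `h(i)²/θ₀(i)` is infinite where `θ₀(i) = 0 ≠ h(i)`, such `h` are
excluded. -/
noncomputable def ellipsoid (n : ℕ) {k : ℕ} (θ : stdSimplex ℝ (Fin (k + 1))) (M : ℝ) :
    Set (Fin (k + 1) → ℝ) :=
  {h | (∀ i, θ i = 0 → h i = 0) ∧ sigmaSq θ h ≤ M ∧ ∑ i, h i = 0 ∧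
    ∀ i, -(√(n : ℝ) * θ i) ≤ h i}

/-- The rescaled deviation `√n (τ(i) - θ₀(i))`, `0 ≤ i ≤ k`; its last `k` coordinates form the
vector `H_n`. -/
noncomputable def deviation (n : ℕ) {k : ℕ} (θ τ : stdSimplex ℝ (Fin (k + 1))) :
    Fin (k + 1) → ℝ :=
  fun i => √(n : ℝ) * (τ i - θ i)

/-- The quadratic form `hᵀ I(θ₀) h` on `ℝ^k`. -/
noncomputable def fisherForm {k : ℕ} (θ : stdSimplex ℝ (Fin (k + 1))) (h : Fin k → ℝ) : ℝ :=
  h ⬝ᵥ (fisherInfo θ *ᵥ h)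

/-- `w(θ₀ + h/√n)`, for a density `w` on `ℝ^k`, which is a function of the coordinates
`1, …, k`. -/
noncomputable def densityAt (n : ℕ) {k : ℕ} (θ : stdSimplex ℝ (Fin (k + 1)))
    (w : (Fin k → ℝ) → ℝ≥0) (h : Fin (k + 1) → ℝ) : ℝ≥0 :=
  w (Fin.tail fun i => θ i + h i / √(n : ℝ))

/-- Condition on the truncation levels: `n inf_{i ≤ k_n} θ₀(i) → +∞`. -/
def TruncationCondition (θ₀ : PMF ℕ+) (k : ℕ → ℕ) : Prop :=
  Tendsto (fun n : ℕ => (n : ℝ) * minProb (truncPmf θ₀ (k n))) atTop atTop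

/-- Prior smoothness: the supremum over `h, g ∈ ℰ_{θ₀,k_n}(M_n)` of
`w_n(θ₀ + h/√n) / w_n(θ₀ + g/√n)` tends to `1`. The ratio is taken in `[0, ∞]`, so that it is
infinite where only the denominator vanishes. -/
def PriorSmoothness (θ₀ : PMF ℕ+) (k : ℕ → ℕ) (w : ∀ n, (Fin (k n) → ℝ) → ℝ≥0) (M : ℕ → ℝ) :
    Prop :=
  Tendsto (fun n : ℕ =>
    ⨆ h ∈ ellipsoid n (truncPmf θ₀ (k n)) (M n), ⨆ g ∈ ellipsoid n (truncPmf θ₀ (k n)) (M n),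
      (densityAt n (truncPmf θ₀ (k n)) (w n) h : ℝ≥0∞) /
        (densityAt n (truncPmf θ₀ (k n)) (w n) g : ℝ≥0∞)) atTop (𝓝 1)

/-- Prior concentration:
`(k_n/2) log n ∨ log det I(θ₀) ∨ (-log w_n(θ₀)) = o(M_n)`, where `-log 0 = +∞`, so that
`w_n(θ₀) > 0` for all large `n`. -/
def PriorConcentration (θ₀ : PMF ℕ+) (k : ℕ → ℕ) (w : ∀ n, (Fin (k n) → ℝ) → ℝ≥0)
    (M : ℕ → ℝ) : Prop :=
  (∀ᶠ n in atTop, 0 < w n (Fin.tail (truncPmf θ₀ (k n)))) ∧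
  (fun n : ℕ => max (max ((k n : ℝ) / 2 * Real.log n)
      (Real.log (fisherInfo (truncPmf θ₀ (k n))).det))
      (-Real.log (w n (Fin.tail (truncPmf θ₀ (k n)))))) =o[atTop] M

/-- `W` is a prior probability distribution for `θ ∈ Θ_k` such that `(θ(1), …, θ(k))` has
density `w` with respect to Lebesgue measure on `ℝ^k`. -/
def IsPriorWithDensity {k : ℕ} (W : Measure (stdSimplex ℝ (Fin (k + 1))))
    (w : (Fin k → ℝ) → ℝ≥0) : Prop :=
  Measurable w ∧ W.map (fun θ : stdSimplex ℝ (Fin (k + 1)) => Fin.tail θ) =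
    (volume : Measure (Fin k → ℝ)).withDensity fun u => (w u : ℝ≥0∞)

/-- The expectation under `ℙ_{n,0}`, the law of an i.i.d. sample from the truncated `θ₀`, of the
posterior probability, given the sample and for the prior `W`, of a set `A` of parameters. -/
noncomputable def expectedPosterior (θ₀ : PMF ℕ+) (n k : ℕ)
    (W : Measure (stdSimplex ℝ (Fin (k + 1)))) [IsProbabilityMeasure W]
    (A : Set (stdSimplex ℝ (Fin (k + 1)))) : ℝ≥0∞ :=
  ∫⁻ x, posterior (model n k) W x A ∂(sampleLaw n (truncPmf θ₀ k))

end PosteriorConcentration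

open PosteriorConcentration

/-!
The quadratic forms `H_nᵀ I(θ₀) H_n` and `σ_n²` of a deviation are both equal to `n χ²(τ, θ₀)`, and
a deviation satisfies the remaining constraints of the ellipsoid. The two events therefore differ by
a level set of a convex function above its minimum, which is Lebesgue-null.

For the limit, take `t = ε M_n` with `ε` small. By Markov's inequality, Pearson's statistic
`n χ²(p_n, θ₀)` of the empirical p.m.f. `p_n` is at most `t` outside an event of probability
`(k_n + 1) / t`. When it is, the likelihood ratio of `τ` to `θ₀` is
* at least `exp (-8t)` if `n χ²(τ, θ₀) ≤ t`,
* at most `exp (-20t)` if `n χ²(τ, θ₀) ≥ M_n`: the likelihood of `τ` falls short of that of `p_n`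
  by a factor `exp (-n H²(p_n, τ))`, where `H` is the Hellinger distance, and
  `H²(τ, θ₀) ≥ χ²(τ, θ₀) / 9` unless `τ` inflates a cell more than fourfold, which alone makes
  `H²(τ, θ₀)` exceed `inf θ₀`, a large multiple of `t / n`.

The inner ball `n χ²(τ, θ₀) ≤ t` has prior mass at least `exp (-t)`, since it contains a cube of
side `2 / n²` around `θ₀` on which the density is at least `w_n(θ₀) / 2`. Bayes' formula then bounds
the posterior mass of the outer region by `exp (-11t)`.
-/

namespace PosteriorConcentration

section Divergences

variable {ι : Type*} [Fintype ι]

/-- The chi-square divergence `∑ (p(i) - q(i))² / q(i)` of `p` from `q`; the cells with `q(i) = 0`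
do not contribute. -/
noncomputable def chiSq (p q : ι → ℝ) : ℝ := ∑ i, (p i - q i) ^ 2 / q i

/-- The squared Hellinger distance `∑ (√p(i) - √q(i))²`, without the factor `1/2`. -/
noncomputable def hellingerSq (p q : ι → ℝ) : ℝ := ∑ i, (√(p i) - √(q i)) ^ 2

theorem chiSq_nonneg (p : ι → ℝ) {q : ι → ℝ} (hq : ∀ i, 0 ≤ q i) : 0 ≤ chiSq p q :=
  Finset.sum_nonneg fun i _ => div_nonneg (sq_nonneg _) (hq i)

theorem hellingerSq_nonneg (p q : ι → ℝ) : 0 ≤ hellingerSq p q :=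
  Finset.sum_nonneg fun _ _ => sq_nonneg _

theorem hellingerSq_comm (p q : ι → ℝ) : hellingerSq p q = hellingerSq q p :=
  Finset.sum_congr rfl fun _ _ => sub_sq_comm _ _

theorem hellingerSq_le_two_mul_add (p q r : ι → ℝ) :
    hellingerSq p r ≤ 2 * (hellingerSq p q + hellingerSq q r) := by
  simp only [hellingerSq, ← Finset.sum_add_distrib, Finset.mul_sum]
  refine Finset.sum_le_sum fun i _ => ?_
  simpa using add_sq_le (a := √(p i) - √(q i)) (b := √(q i) - √(r i))

theorem sq_sub_eq_sq_sqrt_sub_mul {a b : ℝ} (ha : 0 ≤ a) (hb : 0 ≤ b) :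
    (a - b) ^ 2 = (√a - √b) ^ 2 * (√a + √b) ^ 2 := by
  rw [← mul_pow, mul_comm, ← sq_sub_sq, Real.sq_sqrt ha, Real.sq_sqrt hb]

theorem hellingerSq_le_chiSq {p q : ι → ℝ} (hp : ∀ i, 0 ≤ p i) (hq : ∀ i, 0 < q i) :
    hellingerSq p q ≤ chiSq p q := by
  refine Finset.sum_le_sum fun i _ => ?_
  have h : q i ≤ (√(p i) + √(q i)) ^ 2 := by
    simpa [Real.sq_sqrt (hq i).le] using
      pow_le_pow_left₀ (Real.sqrt_nonneg (q i)) (le_add_of_nonneg_left (Real.sqrt_nonneg (p i))) 2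
  rw [le_div_iff₀ (hq i), sq_sub_eq_sq_sqrt_sub_mul (hp i) (hq i).le]
  exact mul_le_mul_of_nonneg_left h (sq_nonneg _)

theorem chiSq_le_nine_mul_hellingerSq {p q : ι → ℝ} (hp : ∀ i, 0 ≤ p i) (hq : ∀ i, 0 < q i)
    (hpq : ∀ i, p i ≤ 4 * q i) : chiSq p q ≤ 9 * hellingerSq p q := by
  simp only [chiSq, hellingerSq, Finset.mul_sum]
  refine Finset.sum_le_sum fun i _ => ?_
  have hsqrt : √(p i) ≤ 2 * √(q i) := by
    rw [Real.sqrt_le_left (by positivity), mul_pow, Real.sq_sqrt (hq i).le]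
    linarith [hpq i]
  have hsum : (√(p i) + √(q i)) ^ 2 ≤ 9 * q i :=
    calc (√(p i) + √(q i)) ^ 2 ≤ (3 * √(q i)) ^ 2 := by gcongr; linarith
      _ = 9 * q i := by rw [mul_pow, Real.sq_sqrt (hq i).le]; norm_num
  rw [div_le_iff₀ (hq i), sq_sub_eq_sq_sqrt_sub_mul (hp i) (hq i).le]
  calc (√(p i) - √(q i)) ^ 2 * (√(p i) + √(q i)) ^ 2 ≤ (√(p i) - √(q i)) ^ 2 * (9 * q i) := by
        gcongr
    _ = 9 * (√(p i) - √(q i)) ^ 2 * q i := by ring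

theorem le_hellingerSq_of_four_mul_le {p q : ι → ℝ} {i : ι} (hq : 0 ≤ q i)
    (hpq : 4 * q i ≤ p i) : q i ≤ hellingerSq p q := by
  have hsqrt : 2 * √(q i) ≤ √(p i) := by
    refine Real.le_sqrt_of_sq_le ?_
    rw [mul_pow, Real.sq_sqrt hq]
    linarith
  calc q i = √(q i) ^ 2 := (Real.sq_sqrt hq).symm
    _ ≤ (√(p i) - √(q i)) ^ 2 := by gcongr; linarith
    _ ≤ hellingerSq p q := Finset.single_le_sum (f := fun i => (√(p i) - √(q i)) ^ 2)
        (fun _ _ => sq_nonneg _) (Finset.mem_univ i)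

theorem le_hellingerSq_of_nine_mul_le_chiSq {p q : ι → ℝ} {r : ℝ} (hp : ∀ i, 0 ≤ p i)
    (hq : ∀ i, 0 < q i) (hr : ∀ i, r ≤ q i) (h : 9 * r ≤ chiSq p q) : r ≤ hellingerSq p q := by
  by_cases hpq : ∀ i, p i ≤ 4 * q i
  · linarith [chiSq_le_nine_mul_hellingerSq hp hq hpq]
  · push Not at hpq
    obtain ⟨i, hi⟩ := hpq
    exact (hr i).trans (le_hellingerSq_of_four_mul_le (hq i).le hi.le)

theorem chiSq_le_of_half_le {p q r : ι → ℝ} (hq : ∀ i, 0 < q i) (hr : ∀ i, q i / 2 ≤ r i) :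
    chiSq p r ≤ 4 * (chiSq p q + chiSq r q) := by
  simp only [chiSq, ← Finset.sum_add_distrib, Finset.mul_sum]
  refine Finset.sum_le_sum fun i _ => ?_
  have hq2 : 0 < q i / 2 := half_pos (hq i)
  have hsq : (p i - r i) ^ 2 ≤ 2 * ((p i - q i) ^ 2 + (r i - q i) ^ 2) := by
    simpa [sub_sq_comm (q i)] using add_sq_le (a := p i - q i) (b := q i - r i)
  calc (p i - r i) ^ 2 / r i ≤ 2 * ((p i - q i) ^ 2 + (r i - q i) ^ 2) / (q i / 2) := by
        gcongr; exact hr i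
    _ = 4 * ((p i - q i) ^ 2 / q i + (r i - q i) ^ 2 / q i) := by ring

theorem half_le_of_four_mul_chiSq_le {p q : ι → ℝ} (hq : ∀ i, 0 < q i) {i : ι}
    (h : 4 * chiSq p q ≤ q i) : q i / 2 ≤ p i := by
  have hterm : (p i - q i) ^ 2 / q i ≤ q i / 4 :=
    (Finset.single_le_sum (f := fun i => (p i - q i) ^ 2 / q i)
      (fun j _ => div_nonneg (sq_nonneg _) (hq j).le) (Finset.mem_univ i)).trans
      (by rw [← chiSq]; linarith)
  rw [div_le_iff₀ (hq i)] at hterm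
  have hsq : (p i - q i) ^ 2 ≤ (q i / 2) ^ 2 := by linarith
  linarith [(abs_le_of_sq_le_sq' hsq (half_pos (hq i)).le).1]

end Divergences

section Likelihood

variable {ι : Type*} [DecidableEq ι] {n : ℕ}

/-- The empirical p.m.f. `i ↦ #{j | x(j) = i} / n` of a sample `x` of size `n`. It vanishes
identically if `n = 0`. -/
noncomputable def empirical (x : Fin n → ι) (i : ι) : ℝ :=
  (Finset.univ.filter fun j => x j = i).card / n

theorem empirical_nonneg (x : Fin n → ι) (i : ι) : 0 ≤ empirical x i := by
  unfold empirical; positivity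

theorem empirical_pos (x : Fin n → ι) (j : Fin n) : 0 < empirical x (x j) :=
  div_pos (Nat.cast_pos.2 (Finset.card_pos.2 ⟨j, by simp⟩)) (Nat.cast_pos.2 (Fin.pos j))

theorem natCast_mul_empirical (x : Fin n → ι) (i : ι) :
    n * empirical x i = (Finset.univ.filter fun j => x j = i).card := by
  rcases n.eq_zero_or_pos with rfl | hn
  · simp
  · exact mul_div_cancel₀ _ (Nat.cast_ne_zero.2 hn.ne')

variable [Fintype ι]

theorem sum_comp_eq_natCast_mul_sum_empirical (x : Fin n → ι) (f : ι → ℝ) :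
    ∑ j, f (x j) = n * ∑ i, empirical x i * f i := by
  simp_rw [Finset.mul_sum, ← mul_assoc, natCast_mul_empirical, ← nsmul_eq_mul,
    ← Finset.sum_const, Finset.sum_fiberwise']

theorem natCast_mul_sum_empirical (x : Fin n → ι) : n * ∑ i, empirical x i = n := by
  simpa using (sum_comp_eq_natCast_mul_sum_empirical x 1).symm

theorem prod_le_exp_mul_prod (x : Fin n → ι) {f g h : ι → ℝ} (hf : ∀ i, 0 ≤ f i)
    (hfg : ∀ j, f (x j) ≤ Real.exp (h (x j)) * g (x j)) :
    ∏ j, f (x j) ≤ Real.exp (n * ∑ i, empirical x i * h i) * ∏ j, g (x j) := by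
  rw [← sum_comp_eq_natCast_mul_sum_empirical, Real.exp_sum, ← Finset.prod_mul_distrib]
  exact Finset.prod_le_prod (fun j _ => hf _) fun j _ => hfg j

theorem le_exp_two_mul_sqrt_div_sub_one_mul {a b : ℝ} (ha : 0 ≤ a) (hb : 0 < b) :
    a ≤ Real.exp (2 * (√(a / b) - 1)) * b := by
  have hexp : √(a / b) ≤ Real.exp (√(a / b) - 1) := by
    linarith [Real.add_one_le_exp (√(a / b) - 1)]
  rw [← div_le_iff₀ hb]
  calc a / b = √(a / b) ^ 2 := (Real.sq_sqrt (by positivity)).symm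
    _ ≤ Real.exp (√(a / b) - 1) ^ 2 := by gcongr
    _ = Real.exp (2 * (√(a / b) - 1)) := by rw [← Real.exp_nat_mul, Nat.cast_ofNat]

theorem le_exp_div_sub_one_mul (a : ℝ) {b : ℝ} (hb : 0 < b) :
    a ≤ Real.exp (a / b - 1) * b := by
  rw [← div_le_iff₀ hb]
  linarith [Real.add_one_le_exp (a / b - 1)]

theorem mul_two_mul_sqrt_div_sub_one {a b : ℝ} (ha : 0 ≤ a) (hb : 0 ≤ b) :
    b * (2 * (√(a / b) - 1)) = a - b - (√b - √a) ^ 2 := by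
  have hsqrt : b * √(a / b) = √b * √a := by
    rw [Real.sqrt_div ha, mul_div_left_comm, Real.div_sqrt, mul_comm]
  linear_combination 2 * hsqrt + Real.sq_sqrt ha + Real.sq_sqrt hb

theorem prod_le_exp_mul_prod_empirical (x : Fin n → ι) (p : stdSimplex ℝ ι) :
    ∏ j, p (x j) ≤
      Real.exp (-(n * hellingerSq (empirical x) p)) * ∏ j, empirical x (x j) := by
  have hexponent : n * ∑ i, empirical x i * (2 * (√(p i / empirical x i) - 1)) =
      -(n * hellingerSq (empirical x) p) := by
    simp_rw [mul_two_mul_sqrt_div_sub_one (stdSimplex.zero_le p _) (empirical_nonneg x _),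
      Finset.sum_sub_distrib, stdSimplex.sum_eq_one p, mul_sub, natCast_mul_sum_empirical,
      hellingerSq]
    ring
  rw [← hexponent]
  exact prod_le_exp_mul_prod x (stdSimplex.zero_le p) fun j =>
    le_exp_two_mul_sqrt_div_sub_one_mul (stdSimplex.zero_le p _) (empirical_pos x j)

theorem prod_empirical_le_exp_mul_prod (x : Fin n → ι) {q : stdSimplex ℝ ι} (hq : ∀ i, 0 < q i) :
    ∏ j, empirical x (x j) ≤ Real.exp (n * chiSq (empirical x) q) * ∏ j, q (x j) := by
  have hterm : ∀ i, empirical x i * (empirical x i / q i - 1) =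
      (empirical x i - q i) ^ 2 / q i + (empirical x i - q i) := fun i => by
    field_simp [(hq i).ne']
    ring
  have hexponent : n * ∑ i, empirical x i * (empirical x i / q i - 1) =
      n * chiSq (empirical x) q := by
    simp_rw [hterm, Finset.sum_add_distrib, Finset.sum_sub_distrib, stdSimplex.sum_eq_one q,
      mul_add, mul_sub, natCast_mul_sum_empirical, chiSq]
    ring
  rw [← hexponent]
  exact prod_le_exp_mul_prod x (empirical_nonneg x) fun j => le_exp_div_sub_one_mul _ (hq _)

theorem prod_le_exp_neg_hellingerSq_mul_prod (x : Fin n → ι) (p : stdSimplex ℝ ι)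
    {q : stdSimplex ℝ ι} (hq : ∀ i, 0 < q i) :
    ∏ j, p (x j) ≤
      Real.exp (-(n * (hellingerSq p q / 2 - 2 * chiSq (empirical x) q))) * ∏ j, q (x j) := by
  have hdist : hellingerSq p q / 2 - 2 * chiSq (empirical x) q ≤
      hellingerSq (empirical x) p - chiSq (empirical x) q := by
    linarith [hellingerSq_le_two_mul_add p (empirical x) q, hellingerSq_comm p (empirical x),
      hellingerSq_le_chiSq (empirical_nonneg x) hq]
  calc ∏ j, p (x j)
      ≤ Real.exp (-(n * hellingerSq (empirical x) p)) *
          (Real.exp (n * chiSq (empirical x) q) * ∏ j, q (x j)) :=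
        (prod_le_exp_mul_prod_empirical x p).trans
          (mul_le_mul_of_nonneg_left (prod_empirical_le_exp_mul_prod x hq) (Real.exp_pos _).le)
    _ = Real.exp (-(n * (hellingerSq (empirical x) p - chiSq (empirical x) q))) *
          ∏ j, q (x j) := by
        rw [← mul_assoc, ← Real.exp_add]
        ring_nf
    _ ≤ _ := by
        gcongr
        exact Finset.prod_nonneg fun j _ => (hq _).le

theorem exp_neg_chiSq_mul_prod_le_prod (x : Fin n → ι) {p q : stdSimplex ℝ ι}
    (hq : ∀ i, 0 < q i) (hpq : ∀ i, q i / 2 ≤ p i) :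
    Real.exp (-(n * (4 * (chiSq (empirical x) q + chiSq p q)))) * ∏ j, q (x j) ≤
      ∏ j, p (x j) := by
  have hp : ∀ i, 0 < p i := fun i => (half_pos (hq i)).trans_le (hpq i)
  rw [Real.exp_neg, inv_mul_le_iff₀ (Real.exp_pos _)]
  calc ∏ j, q (x j) ≤ ∏ j, empirical x (x j) := by
        refine (prod_le_exp_mul_prod_empirical x q).trans (mul_le_of_le_one_left ?_ ?_)
        · exact Finset.prod_nonneg fun j _ => empirical_nonneg x _
        · exact Real.exp_le_one_iff.2
            (neg_nonpos.2 (mul_nonneg n.cast_nonneg (hellingerSq_nonneg _ _)))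
    _ ≤ Real.exp (n * chiSq (empirical x) p) * ∏ j, p (x j) :=
        prod_empirical_le_exp_mul_prod x hp
    _ ≤ _ := by
        gcongr
        · exact Finset.prod_nonneg fun j _ => (hp _).le
        · exact chiSq_le_of_half_le hq hpq

end Likelihood

section Pearson

variable {ι : Type*} [DecidableEq ι] {n : ℕ}

theorem natCast_mul_chiSq_empirical [Fintype ι] (x : Fin n → ι) (q : ι → ℝ) :
    n * chiSq (empirical x) q =
      ∑ i, ((Finset.univ.filter fun j => x j = i).card - n * q i) ^ 2 / (n * q i) := by
  rcases n.eq_zero_or_pos with rfl | hn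
  · simp
  · have hn' : (n : ℝ) ≠ 0 := Nat.cast_ne_zero.2 hn.ne'
    simp_rw [chiSq, Finset.mul_sum, ← natCast_mul_empirical, ← mul_sub, mul_pow]
    refine Finset.sum_congr rfl fun i _ => ?_
    rw [sq (n : ℝ), mul_assoc, mul_div_mul_left _ _ hn', mul_div_assoc]

variable [MeasurableSpace ι] [MeasurableSingletonClass ι] (μ : Measure ι) [IsProbabilityMeasure μ]

theorem integral_sq_card_filter_sub_le [Finite ι] (i : ι) :
    ∫ x, ((Finset.univ.filter fun j : Fin n => x j = i).card - n * μ.real {i}) ^ 2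
      ∂Measure.pi (fun _ => μ) ≤ n * μ.real {i} := by
  have hmean : ∫ a, (if a = i then (1 : ℝ) else 0) ∂μ = μ.real {i} := by
    simpa [Set.indicator_apply] using integral_indicator_one (μ := μ) (measurableSet_singleton i)
  have hmean_sum :
      ∫ x, ∑ j, (if x j = i then (1 : ℝ) else 0) ∂Measure.pi (fun _ : Fin n => μ) =
        n * μ.real {i} := by
    rw [integral_finsetSum _ fun _ _ => Integrable.of_finite]
    have hcoord : ∀ j : Fin n, ∫ x, (if x j = i then (1 : ℝ) else 0) ∂Measure.pi (fun _ => μ) =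
        μ.real {i} := fun j =>
      (integral_comp_eval (μ := fun _ : Fin n => μ)
        (f := fun a => if a = i then (1 : ℝ) else 0) .of_discrete).trans hmean
    simp [hcoord]
  have hvar := variance_sum_pi (μ := fun _ : Fin n => μ)
    (X := fun _ a => if a = i then (1 : ℝ) else 0) fun _ => MemLp.of_discrete
  rw [variance_eq_integral Measurable.of_discrete.aemeasurable] at hvar
  simp only [Finset.sum_apply, hmean_sum] at hvar
  simp_rw [Finset.natCast_card_filter]
  rw [hvar, Finset.sum_const, Finset.card_univ, Fintype.card_fin, nsmul_eq_mul]
  gcongr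
  calc Var[fun a => if a = i then (1 : ℝ) else 0; μ]
      ≤ ∫ a, (if a = i then (1 : ℝ) else 0) ^ 2 ∂μ :=
        variance_le_expectation_sq Measurable.of_discrete.aestronglyMeasurable
    _ = μ.real {i} := by simpa using hmean

theorem integral_natCast_mul_chiSq_empirical_le [Fintype ι] :
    ∫ x, n * chiSq (empirical x) (fun i => μ.real {i}) ∂Measure.pi (fun _ : Fin n => μ) ≤
      Fintype.card ι := by
  simp_rw [natCast_mul_chiSq_empirical]
  rw [integral_finsetSum _ fun _ _ => Integrable.of_finite]
  calc _ ≤ ∑ _i : ι, (1 : ℝ) := by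
        refine Finset.sum_le_sum fun i _ => ?_
        rw [integral_div]
        exact div_le_one_of_le₀ (integral_sq_card_filter_sub_le μ i) (by positivity)
    _ = Fintype.card ι := by simp

theorem sampleLaw_lt_chiSq_empirical_le {k : ℕ} (θ : stdSimplex ℝ (Fin (k + 1))) {t : ℝ}
    (ht : 0 < t) :
    sampleLaw n θ {x | t < n * chiSq (empirical x) θ} ≤ ENNReal.ofReal ((k + 1) / t) := by
  have hθ : (fun i => (pmfMeasure θ).real {i}) = θ := by
    ext i
    rw [Measure.real, pmfMeasure_singleton, ENNReal.toReal_ofReal (stdSimplex.zero_le θ i)]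
  have hmean := integral_natCast_mul_chiSq_empirical_le (n := n) (pmfMeasure θ)
  rw [hθ, Fintype.card_fin, Nat.cast_succ] at hmean
  have hmarkov := mul_meas_ge_le_integral_of_nonneg (μ := sampleLaw n θ)
    (ae_of_all _ fun x => mul_nonneg n.cast_nonneg
      (chiSq_nonneg (empirical x) (stdSimplex.zero_le θ))) Integrable.of_finite t
  have htail : (sampleLaw n θ).real {x | t ≤ n * chiSq (empirical x) θ} ≤ (k + 1) / t := by
    rw [le_div_iff₀' ht]
    exact hmarkov.trans hmean
  exact (measure_mono fun x (hx : t < _) => hx.le).trans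
    ((ENNReal.le_ofReal_iff_toReal_le (measure_ne_top _ _) (by positivity)).2 htail)

end Pearson

section Bayes

variable {Ω 𝓧 : Type*} [MeasurableSpace Ω] [MeasurableSpace 𝓧]

theorem absolutelyContinuous_comp_of_forall_mem {κ : Kernel Ω 𝓧} {μ : Measure Ω} {ν : Measure 𝓧}
    {B : Set Ω} (hB : μ B ≠ 0) (h : ∀ ω ∈ B, ν ≪ κ ω) : ν ≪ κ ∘ₘ μ := by
  refine Measure.AbsolutelyContinuous.mk fun s hs hs0 => ?_
  rw [Measure.bind_apply hs κ.aemeasurable, lintegral_eq_zero_iff (κ.measurable_coe hs)] at hs0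
  obtain ⟨ω, hωB, hω⟩ := ((frequently_ae_mem_iff.2 hB).and_eventually hs0).exists
  exact h ω hωB hω

variable [StandardBorelSpace Ω] [Nonempty Ω] (κ : Kernel Ω 𝓧) [IsFiniteKernel κ]

theorem lintegral_posterior_congr [Countable 𝓧] [MeasurableSingletonClass 𝓧] {μ : Measure Ω}
    [IsFiniteMeasure μ] {ν : Measure 𝓧} (hν : ν ≪ κ ∘ₘ μ) {A A' : Set Ω} (h : A =ᵐ[μ] A') :
    ∫⁻ x, posterior κ μ x A ∂ν = ∫⁻ x, posterior κ μ x A' ∂ν := by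
  have hac : ∀ᵐ x ∂(κ ∘ₘ μ), posterior κ μ x ≪ μ :=
    absolutelyContinuous_posterior (ν := Measure.count) (ae_of_all _ fun ω s hs => by
      rw [Measure.count_eq_zero_iff.1 hs, measure_empty])
  refine lintegral_congr_ae ?_
  filter_upwards [hν.ae_le hac] with x hx
  exact measure_congr (hx.ae_eq h)

variable [MeasurableSingletonClass 𝓧] (x : 𝓧) {A B : Set Ω}

theorem comp_singleton_mul_posterior (μ : Measure Ω) [IsFiniteMeasure μ] (hA : MeasurableSet A) :
    (κ ∘ₘ μ) {x} * posterior κ μ x A = ∫⁻ ω in A, κ ω {x} ∂μ := by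
  have hx := measurableSet_singleton x
  calc (κ ∘ₘ μ) {x} * posterior κ μ x A
      = ((κ ∘ₘ μ) ⊗ₘ posterior κ μ) ({x} ×ˢ A) := by
        rw [Measure.compProd_apply_prod hx hA, lintegral_singleton, mul_comm]
    _ = (μ ⊗ₘ κ) (A ×ˢ {x}) := by
        rw [compProd_posterior_eq_map_swap, Measure.map_apply measurable_swap (hx.prod hA),
          Set.preimage_swap_prod]
    _ = ∫⁻ ω in A, κ ω {x} ∂μ := Measure.compProd_apply_prod hA hx

theorem posterior_mul_le (μ : Measure Ω) [IsProbabilityMeasure μ] (hA : MeasurableSet A)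
    (hB : MeasurableSet B) {a b : ℝ≥0∞} (ha : ∀ ω ∈ A, κ ω {x} ≤ a) (hb : ∀ ω ∈ B, b ≤ κ ω {x}) :
    b * μ B * posterior κ μ x A ≤ a := by
  have hmarginal : b * μ B ≤ (κ ∘ₘ μ) {x} := by
    rw [Measure.bind_apply (measurableSet_singleton x) κ.aemeasurable, ← setLIntegral_const]
    exact (setLIntegral_mono' hB hb).trans (setLIntegral_le_lintegral B _)
  calc b * μ B * posterior κ μ x A
      ≤ (κ ∘ₘ μ) {x} * posterior κ μ x A := mul_le_mul_left hmarginal _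
    _ = ∫⁻ ω in A, κ ω {x} ∂μ := comp_singleton_mul_posterior κ x μ hA
    _ ≤ ∫⁻ _ in A, a ∂μ := setLIntegral_mono' hA ha
    _ ≤ a := by
        rw [setLIntegral_const]
        exact mul_le_of_le_one_right' prob_le_one

end Bayes

theorem addHaar_setOf_eq_of_convexOn {E : Type*} [NormedAddCommGroup E] [NormedSpace ℝ E]
    [FiniteDimensional ℝ E] [MeasurableSpace E] [BorelSpace E] (μ : Measure E) [μ.IsAddHaarMeasure]
    {f : E → ℝ} (hf : ConvexOn ℝ Set.univ f) {c : E} {r : ℝ} (hc : f c < r) :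
    μ {u | f u = r} = 0 := by
  have hconv : Convex ℝ {u | f u ≤ r} := by simpa using hf.convex_le r
  refine measure_mono_null (fun u (hu : f u = r) => ?_) (hconv.addHaar_frontier μ)
  refine ⟨subset_closure hu.le, fun hint => ?_⟩
  -- Beyond `u` on the ray from `c`, the values of `f` exceed `r`.
  have hcont : ContinuousAt (fun t : ℝ => AffineMap.lineMap c u t) 1 := by fun_prop
  have hnhds : ∀ᶠ t in 𝓝[>] (1 : ℝ), f (AffineMap.lineMap c u t) ≤ r :=
    (hcont.tendsto.mono_left nhdsWithin_le_nhds).eventually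
      (by simpa using! mem_interior_iff_mem_nhds.1 hint)
  obtain ⟨t, ht, ht1 : 1 < t⟩ := (hnhds.and self_mem_nhdsWithin).exists
  have hseg : u ∈ openSegment ℝ c (AffineMap.lineMap c u t) := by
    have ht0 : 0 < t := one_pos.trans ht1
    refine ⟨1 - t⁻¹, t⁻¹, sub_pos.2 (inv_lt_one_of_one_lt₀ ht1), inv_pos.2 ht0, by ring, ?_⟩
    rw [← AffineMap.lineMap_apply_module]
    simp [AffineMap.lineMap_apply, ht0.ne']
  have := hf.lt_right_of_left_lt (Set.mem_univ c) (Set.mem_univ _) hseg (hc.trans_eq hu.symm)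
  linarith

section FisherForm

variable {k : ℕ} (θ : stdSimplex ℝ (Fin (k + 1)))

theorem fisherForm_eq (h : Fin k → ℝ) :
    fisherForm θ h = ∑ i, h i ^ 2 / θ i.succ + (∑ i, h i) ^ 2 / θ 0 := by
  have hmul : fisherInfo θ *ᵥ h = fun i => h i / θ i.succ + (∑ j, h j) / θ 0 := by
    ext i
    rw [fisherInfo, Matrix.add_mulVec, Pi.add_apply, Matrix.mulVec_diagonal]
    simp only [Matrix.mulVec, dotProduct, Matrix.of_apply, ← Finset.mul_sum]
    ring
  simp only [fisherForm, dotProduct, hmul, mul_add, Finset.sum_add_distrib, ← Finset.sum_mul, sq,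
    mul_div_assoc]

theorem fisherForm_smul (c : ℝ) (h : Fin k → ℝ) :
    fisherForm θ (c • h) = c ^ 2 * fisherForm θ h := by
  simp only [fisherForm, Matrix.mulVec_smul, dotProduct_smul, smul_dotProduct, smul_eq_mul, sq,
    mul_assoc]

theorem fisherForm_tail {h : Fin (k + 1) → ℝ} (hh : ∑ i, h i = 0) :
    fisherForm θ (Fin.tail h) = sigmaSq θ h := by
  rw [Fin.sum_univ_succ, ← eq_neg_iff_add_eq_zero] at hh
  rw [fisherForm_eq, sigmaSq, Fin.sum_univ_succ, hh, neg_sq, add_comm]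
  rfl

theorem fisherForm_tail_sub_tail (τ : stdSimplex ℝ (Fin (k + 1))) :
    fisherForm θ (Fin.tail τ - Fin.tail θ) = chiSq τ θ :=
  fisherForm_tail θ (h := fun i => τ i - θ i) (by simp)

theorem fisherForm_tail_deviation (n : ℕ) (τ : stdSimplex ℝ (Fin (k + 1))) :
    fisherForm θ (Fin.tail (deviation n θ τ)) = n * chiSq τ θ := by
  rw [← fisherForm_tail_sub_tail, ← Real.sq_sqrt (Nat.cast_nonneg n), ← fisherForm_smul]
  rfl

theorem deviation_mem_ellipsoid_iff {θ : stdSimplex ℝ (Fin (k + 1))} (hθ : ∀ i, 0 < θ i) (n : ℕ)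
    (M : ℝ) (τ : stdSimplex ℝ (Fin (k + 1))) :
    deviation n θ τ ∈ ellipsoid n θ M ↔ n * chiSq τ θ ≤ M := by
  have hsum : ∑ i, deviation n θ τ i = 0 := by simp [deviation, ← Finset.mul_sum]
  rw [← fisherForm_tail_deviation, fisherForm_tail θ hsum]
  refine ⟨fun h => h.2.1, fun h => ⟨fun i hi => absurd hi (hθ i).ne', h, hsum, fun i => ?_⟩⟩
  rw [deviation, mul_sub, neg_le_sub_iff_le_add]
  exact le_add_of_nonneg_left (mul_nonneg (Real.sqrt_nonneg _) (stdSimplex.zero_le τ i))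

theorem convexOn_fisherForm : ConvexOn ℝ Set.univ (fisherForm θ) := by
  have hsq : ∀ (ℓ : (Fin k → ℝ) →ₗ[ℝ] ℝ) (i : Fin (k + 1)),
      ConvexOn ℝ Set.univ fun h => ℓ h ^ 2 / θ i := fun ℓ i => by
    simpa [div_eq_inv_mul] using
      ((even_two.convexOn_pow).comp_linearMap ℓ).smul (inv_nonneg.2 (stdSimplex.zero_le θ i))
  have hsum : ConvexOn ℝ Set.univ fun h : Fin k → ℝ => ∑ i, h i ^ 2 / θ i.succ := by
    convert Finset.sum_induction (s := Finset.univ) (fun (i : Fin k) (h : Fin k → ℝ) =>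
      h i ^ 2 / θ i.succ) (ConvexOn ℝ Set.univ) (fun _ _ => ConvexOn.add)
      (convexOn_const 0 convex_univ) fun i _ => hsq (LinearMap.proj i) i.succ
    simp
  simpa only [funext (fisherForm_eq θ), LinearMap.coe_sum, Finset.sum_apply,
    LinearMap.proj_apply] using! hsum.add (hsq (∑ i, LinearMap.proj i) 0)

end FisherForm

section Prior

variable {k : ℕ} {θ : stdSimplex ℝ (Fin (k + 1))} {W : Measure (stdSimplex ℝ (Fin (k + 1)))}

theorem measurable_chiSq (θ : stdSimplex ℝ (Fin (k + 1))) :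
    Measurable fun τ : stdSimplex ℝ (Fin (k + 1)) => chiSq τ θ :=
  Finset.measurable_sum _ fun i _ =>
    (((measurable_pi_apply i).comp measurable_subtype_coe).sub_const _ |>.pow_const 2).div_const _

theorem measurable_tail_stdSimplex :
    Measurable fun τ : stdSimplex ℝ (Fin (k + 1)) => (Fin.tail τ : Fin k → ℝ) :=
  measurable_pi_lambda _ fun i => (measurable_pi_apply i.succ).comp measurable_subtype_coe

theorem measure_chiSq_eq_zero
    (hW : W.map (fun τ : stdSimplex ℝ (Fin (k + 1)) => Fin.tail τ) ≪ (volume : Measure (Fin k → ℝ)))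
    {r : ℝ} (hr : 0 < r) : W {τ | chiSq τ θ = r} = 0 := by
  have hconv : ConvexOn ℝ Set.univ fun u => fisherForm θ (u - Fin.tail θ) := by
    simpa [Function.comp_def, sub_eq_add_neg] using
      (convexOn_fisherForm θ).translate_left (-Fin.tail θ)
  have hnull := hW (addHaar_setOf_eq_of_convexOn volume hconv (c := Fin.tail θ) (r := r)
    (by simpa [fisherForm] using hr))
  simp_rw [← fisherForm_tail_sub_tail]
  exact Measure.preimage_null_of_map_null measurable_tail_stdSimplex.aemeasurable hnull

end Prior

section PriorMass

variable {n k : ℕ} {θ : stdSimplex ℝ (Fin (k + 1))}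

theorem pos_of_le_natCast_mul {a b : ℝ} (ha : 0 < a) (h : a ≤ n * b) : 0 < b :=
  pos_of_mul_pos_right (ha.trans_le h) n.cast_nonneg

theorem fisherForm_le {a : ℝ} (ha : 0 < a) (hθ : ∀ i, a ≤ θ i) (v : Fin k → ℝ) :
    fisherForm θ v ≤ k * (k + 1) * ‖v‖ ^ 2 / a := by
  have hv : ∀ i, |v i| ≤ ‖v‖ := norm_le_pi_norm v
  have hsum : |∑ i, v i| ≤ k * ‖v‖ :=
    calc |∑ i, v i| ≤ ∑ i, |v i| := Finset.abs_sum_le_sum_abs _ _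
      _ ≤ ∑ _i : Fin k, ‖v‖ := Finset.sum_le_sum fun i _ => hv i
      _ = k * ‖v‖ := by simp
  calc fisherForm θ v = ∑ i, v i ^ 2 / θ i.succ + (∑ i, v i) ^ 2 / θ 0 := fisherForm_eq θ v
    _ ≤ ∑ _i : Fin k, ‖v‖ ^ 2 / a + (k * ‖v‖) ^ 2 / a := by
        gcongr ∑ i, ?_ + ?_ with i
        · exact div_le_div₀ (sq_nonneg _) (sq_le_sq.2 (by simpa using hv i)) ha (hθ _)
        · exact div_le_div₀ (sq_nonneg _) (sq_le_sq.2 (hsum.trans (le_abs_self _))) ha (hθ 0)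
    _ = k * (k + 1) * ‖v‖ ^ 2 / a := by
        simp only [Finset.sum_const, Finset.card_univ, Fintype.card_fin, nsmul_eq_mul]
        ring

theorem natCast_mul_fisherForm_sub_le_one (hθ : ∀ i, 1 ≤ n * θ i) {u : Fin k → ℝ}
    (hu : u ∈ Metric.closedBall (Fin.tail θ) (((n : ℝ) ^ 2)⁻¹)) :
    n * fisherForm θ (u - Fin.tail θ) ≤ 1 := by
  have hn : (0 : ℝ) < n := pos_of_mul_pos_left (one_pos.trans_le (hθ 0)) (stdSimplex.zero_le θ 0)
  have hkn : k + 1 ≤ (n : ℝ) := by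
    simpa [← Finset.mul_sum] using Finset.sum_le_sum fun i (_ : i ∈ Finset.univ) => hθ i
  have hform := fisherForm_le (inv_pos.2 hn) (fun i => (inv_le_iff_one_le_mul₀' hn).2 (hθ i))
    (u - Fin.tail θ)
  rw [mem_closedBall_iff_norm] at hu
  calc n * fisherForm θ (u - Fin.tail θ)
      ≤ n * (n * n * (((n : ℝ) ^ 2)⁻¹) ^ 2 / (n : ℝ)⁻¹) := by
        refine mul_le_mul_of_nonneg_left (hform.trans ?_) hn.le
        have hk : k ≤ n := by exact_mod_cast (le_add_of_nonneg_right zero_le_one).trans hkn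
        gcongr
    _ = 1 := by field_simp

theorem exists_mem_ellipsoid_densityAt_eq (hθ : ∀ i, 1 ≤ n * θ i) {u : Fin k → ℝ}
    (hu : n * fisherForm θ (u - Fin.tail θ) ≤ 1) (w : (Fin k → ℝ) → ℝ≥0) :
    ∃ h ∈ ellipsoid n θ 1, densityAt n θ w h = w u := by
  have hn : (0 : ℝ) < n := pos_of_mul_pos_left (one_pos.trans_le (hθ 0)) (stdSimplex.zero_le θ 0)
  have hs : 0 < √(n : ℝ) := Real.sqrt_pos.2 hn
  have hθ0 : ∀ i, 0 < θ i := fun i => pos_of_le_natCast_mul one_pos (hθ i)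
  set v := √(n : ℝ) • (u - Fin.tail θ) with hv
  set h : Fin (k + 1) → ℝ := Fin.cons (-∑ i, v i) v with hh
  have hsum : ∑ i, h i = 0 := by simp [hh, Fin.sum_univ_succ]
  have hsigma : sigmaSq θ h ≤ 1 := by
    rwa [← fisherForm_tail θ hsum, hh, Fin.tail_cons, hv, fisherForm_smul, Real.sq_sqrt hn.le]
  refine ⟨h, ⟨fun i hi => absurd hi (hθ0 i).ne', hsigma, hsum, fun i => ?_⟩, ?_⟩
  · have hterm : h i ^ 2 / θ i ≤ n * θ i :=
      (Finset.single_le_sum (f := fun i => h i ^ 2 / θ i)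
        (fun j _ => div_nonneg (sq_nonneg _) (hθ0 j).le) (Finset.mem_univ i)).trans
        (hsigma.trans (hθ i))
    refine neg_le_of_abs_le (abs_le_of_sq_le_sq ?_ (mul_nonneg hs.le (hθ0 i).le))
    rw [div_le_iff₀ (hθ0 i)] at hterm
    rw [mul_pow, Real.sq_sqrt hn.le]
    linarith
  · rw [densityAt]
    congr 1
    ext i
    simp [Fin.tail, hh, hv, mul_div_cancel_left₀ _ hs.ne']

theorem mul_ofReal_le_prior {W : Measure (stdSimplex ℝ (Fin (k + 1)))} {w : (Fin k → ℝ) → ℝ≥0}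
    (hW : IsPriorWithDensity W w) (hθ : ∀ i, 1 ≤ n * θ i) {c : ℝ≥0}
    (hc : ∀ h ∈ ellipsoid n θ 1, c ≤ densityAt n θ w h) :
    c * ENNReal.ofReal ((2 * ((n : ℝ) ^ 2)⁻¹) ^ k) ≤ W {τ | n * chiSq τ θ ≤ 1} := by
  set C := Metric.closedBall (Fin.tail θ : Fin k → ℝ) (((n : ℝ) ^ 2)⁻¹) with hC
  have hC_meas : MeasurableSet C := Metric.isClosed_closedBall.measurableSet
  calc c * ENNReal.ofReal ((2 * ((n : ℝ) ^ 2)⁻¹) ^ k)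
      = ∫⁻ _ in C, c := by
        rw [setLIntegral_const, hC, Real.volume_pi_closedBall _ (by positivity), Fintype.card_fin]
    _ ≤ ∫⁻ u in C, w u := by
        refine setLIntegral_mono' hC_meas fun u hu => ENNReal.coe_le_coe.2 ?_
        obtain ⟨h, hh, hhu⟩ :=
          exists_mem_ellipsoid_densityAt_eq hθ (natCast_mul_fisherForm_sub_le_one hθ hu) w
        exact hhu ▸ hc h hh
    _ = W ((fun τ : stdSimplex ℝ (Fin (k + 1)) => (Fin.tail τ : Fin k → ℝ)) ⁻¹' C) := by
        rw [← withDensity_apply _ hC_meas, ← hW.2,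
          Measure.map_apply measurable_tail_stdSimplex hC_meas]
    _ ≤ W {τ | n * chiSq τ θ ≤ 1} := measure_mono fun τ hτ => by
        simpa only [fisherForm_tail_sub_tail] using! natCast_mul_fisherForm_sub_le_one hθ hτ

theorem exp_neg_six_mul_le {a s : ℝ} (hn : 0 < n) (ha : 0 < a) (hs : 1 ≤ s)
    (hk : (k : ℝ) / 2 * Real.log n ≤ s) (hlog : -Real.log a ≤ s) :
    Real.exp (-(6 * s)) ≤ a / 2 * (2 * ((n : ℝ) ^ 2)⁻¹) ^ k := by
  have hk2 : 0 ≤ k * Real.log 2 := mul_nonneg k.cast_nonneg (Real.log_nonneg one_le_two)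
  rw [← Real.le_log_iff_exp_le (by positivity), Real.log_mul (by positivity) (by positivity),
    Real.log_div ha.ne' two_ne_zero, Real.log_pow, Real.log_mul two_ne_zero (by positivity),
    Real.log_inv, Real.log_pow]
  push_cast
  linarith [Real.log_two_lt_d9]

end PriorMass

section FixedSampleSize

variable {n k : ℕ} {θ : stdSimplex ℝ (Fin (k + 1))}

theorem sampleLaw_singleton_eq_ofReal (τ : stdSimplex ℝ (Fin (k + 1))) (x : Fin n → Fin (k + 1)) :
    sampleLaw n τ {x} = ENNReal.ofReal (∏ j, τ (x j)) := by
  rw [sampleLaw_singleton, ENNReal.ofReal_prod_of_nonneg fun j _ => stdSimplex.zero_le τ (x j)]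

theorem sampleLaw_singleton_pos (hθ : ∀ i, 0 < θ i) (x : Fin n → Fin (k + 1)) :
    0 < sampleLaw n θ {x} := by
  rw [sampleLaw_singleton_eq_ofReal, ENNReal.ofReal_pos]
  exact Finset.prod_pos fun j _ => hθ _

theorem absolutelyContinuous_sampleLaw {ν : Measure (Fin n → Fin (k + 1))} (hθ : ∀ i, 0 < θ i) :
    ν ≪ sampleLaw n θ := fun s hs => by
  have : s = ∅ := Set.eq_empty_of_forall_notMem fun x hx =>
    (sampleLaw_singleton_pos hθ x).ne' (measure_mono_null (Set.singleton_subset_iff.2 hx) hs)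
  rw [this, measure_empty]

theorem half_le_of_natCast_mul_chiSq_le {t : ℝ} (ht : 0 < t) (hθ : ∀ i, 4 * t ≤ n * θ i)
    {τ : stdSimplex ℝ (Fin (k + 1))} (hτ : n * chiSq τ θ ≤ t) (i : Fin (k + 1)) :
    θ i / 2 ≤ τ i := by
  have hθ0 : ∀ i, 0 < θ i := fun i => pos_of_le_natCast_mul (by linarith) (hθ i)
  have hn : (0 : ℝ) < n := pos_of_mul_pos_left (by linarith [hθ i]) (hθ0 i).le
  refine half_le_of_four_mul_chiSq_le hθ0 (le_of_mul_le_mul_left ?_ hn)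
  linarith [hθ i]

variable {t : ℝ} {x : Fin n → Fin (k + 1)}

theorem sampleLaw_singleton_le (ht : 0 < t) (hθ : ∀ i, 44 * t ≤ n * θ i)
    (hx : n * chiSq (empirical x) θ ≤ t) {τ : stdSimplex ℝ (Fin (k + 1))}
    (hτ : 396 * t ≤ n * chiSq τ θ) :
    sampleLaw n τ {x} ≤ ENNReal.ofReal (Real.exp (-(20 * t))) * sampleLaw n θ {x} := by
  have hθ0 : ∀ i, 0 < θ i := fun i => pos_of_le_natCast_mul (by linarith) (hθ i)
  have hn : (0 : ℝ) < n := pos_of_mul_pos_left (by linarith [hθ 0]) (hθ0 0).le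
  have hhellinger : 44 * t / n ≤ hellingerSq τ θ := by
    refine le_hellingerSq_of_nine_mul_le_chiSq (stdSimplex.zero_le τ) hθ0
      (fun i => (div_le_iff₀' hn).2 (hθ i)) ?_
    rw [mul_div_assoc', div_le_iff₀' hn]
    linarith
  rw [div_le_iff₀' hn] at hhellinger
  simp_rw [sampleLaw_singleton_eq_ofReal]
  rw [← ENNReal.ofReal_mul (Real.exp_pos _).le]
  refine ENNReal.ofReal_le_ofReal ((prod_le_exp_neg_hellingerSq_mul_prod x τ hθ0).trans ?_)
  refine mul_le_mul_of_nonneg_right (Real.exp_le_exp.2 ?_)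
    (Finset.prod_nonneg fun j _ => (hθ0 _).le)
  linarith

theorem le_sampleLaw_singleton (ht : 0 < t) (hθ : ∀ i, 4 * t ≤ n * θ i)
    (hx : n * chiSq (empirical x) θ ≤ t) {τ : stdSimplex ℝ (Fin (k + 1))}
    (hτ : n * chiSq τ θ ≤ t) :
    ENNReal.ofReal (Real.exp (-(8 * t))) * sampleLaw n θ {x} ≤ sampleLaw n τ {x} := by
  have hθ0 : ∀ i, 0 < θ i := fun i => pos_of_le_natCast_mul (by linarith) (hθ i)
  simp_rw [sampleLaw_singleton_eq_ofReal]
  rw [← ENNReal.ofReal_mul (Real.exp_pos _).le]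
  refine ENNReal.ofReal_le_ofReal (le_trans ?_ (exp_neg_chiSq_mul_prod_le_prod x hθ0
    (half_le_of_natCast_mul_chiSq_le ht hθ hτ)))
  refine mul_le_mul_of_nonneg_right (Real.exp_le_exp.2 ?_)
    (Finset.prod_nonneg fun j _ => (hθ0 _).le)
  linarith

variable {W : Measure (stdSimplex ℝ (Fin (k + 1)))} [IsProbabilityMeasure W] {M : ℝ}

theorem posterior_chiSq_ge_le (ht : 0 < t) (hθ : ∀ i, 44 * t ≤ n * θ i)
    (hx : n * chiSq (empirical x) θ ≤ t) (hM : 396 * t ≤ M)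
    (hW : ENNReal.ofReal (Real.exp (-t)) ≤ W {τ | n * chiSq τ θ ≤ t}) :
    posterior (model n k) W x {τ | M ≤ n * chiSq τ θ} ≤
      ENNReal.ofReal (Real.exp (-(11 * t))) := by
  have hθ0 : ∀ i, 0 < θ i := fun i => pos_of_le_natCast_mul (by linarith) (hθ i)
  have hmeas := (measurable_chiSq θ).const_mul (n : ℝ)
  set L := sampleLaw n θ {x}
  have hbayes := posterior_mul_le (model n k) x W
    (measurableSet_le measurable_const hmeas) (measurableSet_le hmeas measurable_const)
    (fun τ hτ => sampleLaw_singleton_le ht hθ hx (hM.trans hτ))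
    (fun τ hτ => le_sampleLaw_singleton ht (fun i => by linarith [hθ i]) hx hτ)
  set d := ENNReal.ofReal (Real.exp (-(8 * t))) * L * ENNReal.ofReal (Real.exp (-t)) with hd
  have hd0 : d ≠ 0 := by
    simp [hd, L, (sampleLaw_singleton_pos hθ0 x).ne', Real.exp_pos]
  have hd_top : d ≠ ⊤ := by finiteness
  have hexp : ENNReal.ofReal (Real.exp (-(20 * t))) * L =
      d * ENNReal.ofReal (Real.exp (-(11 * t))) := by
    rw [hd, mul_right_comm _ L, mul_right_comm _ L, ← ENNReal.ofReal_mul (Real.exp_pos _).le,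
      ← Real.exp_add, ← ENNReal.ofReal_mul (Real.exp_pos _).le, ← Real.exp_add]
    ring_nf
  rw [← ENNReal.mul_le_mul_iff_right hd0 hd_top, ← hexp]
  exact (mul_le_mul_left (mul_le_mul_right hW _) _).trans hbayes

theorem lintegral_posterior_chiSq_ge_le (ht : 0 < t) (hθ : ∀ i, 44 * t ≤ n * θ i)
    (hM : 396 * t ≤ M) (hW : ENNReal.ofReal (Real.exp (-t)) ≤ W {τ | n * chiSq τ θ ≤ t}) :
    ∫⁻ x, posterior (model n k) W x {τ | M ≤ n * chiSq τ θ} ∂sampleLaw n θ ≤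
      ENNReal.ofReal ((k + 1) / t) + ENNReal.ofReal (Real.exp (-(11 * t))) := by
  set G : Set (Fin n → Fin (k + 1)) := {x | t < n * chiSq (empirical x) θ}
  have hpointwise : ∀ x, posterior (model n k) W x {τ | M ≤ n * chiSq τ θ} ≤
      G.indicator 1 x + ENNReal.ofReal (Real.exp (-(11 * t))) := fun x => by
    by_cases hx : x ∈ G
    · rw [Set.indicator_of_mem hx]
      exact prob_le_one.trans le_self_add
    · exact (posterior_chiSq_ge_le ht hθ (not_lt.1 hx) hM hW).trans le_add_self
  calc _ ≤ ∫⁻ x, G.indicator 1 x + ENNReal.ofReal (Real.exp (-(11 * t))) ∂sampleLaw n θ :=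
        lintegral_mono hpointwise
    _ = sampleLaw n θ G + ENNReal.ofReal (Real.exp (-(11 * t))) := by
        rw [lintegral_add_right _ measurable_const,
          lintegral_indicator_one G.toFinite.measurableSet, lintegral_const, measure_univ, mul_one]
    _ ≤ _ := by
        gcongr
        exact sampleLaw_lt_chiSq_empirical_le θ ht

theorem lintegral_posterior_chiSq_ge_eq_gt (ht : 0 < t) (hθ : ∀ i, 4 * t ≤ n * θ i) (hM : 0 < M)
    (hW_ac : W.map (fun τ : stdSimplex ℝ (Fin (k + 1)) => Fin.tail τ) ≪
      (volume : Measure (Fin k → ℝ)))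
    (hW : W {τ | n * chiSq τ θ ≤ t} ≠ 0) (ν : Measure (Fin n → Fin (k + 1))) :
    ∫⁻ x, posterior (model n k) W x {τ | M ≤ n * chiSq τ θ} ∂ν =
      ∫⁻ x, posterior (model n k) W x {τ | M < n * chiSq τ θ} ∂ν := by
  have hθ0 : ∀ i, 0 < θ i := fun i => pos_of_le_natCast_mul (by linarith) (hθ i)
  have hn : (0 : ℝ) < n := pos_of_mul_pos_left (by linarith [hθ 0]) (hθ0 0).le
  refine lintegral_posterior_congr _ (absolutelyContinuous_comp_of_forall_mem hW fun τ hτ =>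
    absolutelyContinuous_sampleLaw fun i =>
      (half_pos (hθ0 i)).trans_le (half_le_of_natCast_mul_chiSq_le ht hθ hτ i)) ?_
  have hne : ∀ᵐ τ : stdSimplex ℝ (Fin (k + 1)) ∂W, chiSq τ θ ≠ M / n := by
    simpa [ae_iff] using measure_chiSq_eq_zero hW_ac (θ := θ) (div_pos hM hn)
  filter_upwards [hne] with τ hτ
  rw [Ne, eq_div_iff hn.ne', mul_comm] at hτ
  exact propext (Ne.symm hτ).le_iff_lt

end FixedSampleSize

section Conditions

theorem minProb_nonneg {k : ℕ} (θ : stdSimplex ℝ (Fin (k + 1))) : 0 ≤ minProb θ :=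
  Real.iInf_nonneg (stdSimplex.zero_le θ)

theorem minProb_le {k : ℕ} (θ : stdSimplex ℝ (Fin (k + 1))) (i : Fin (k + 1)) : minProb θ ≤ θ i :=
  ciInf_le (Set.finite_range _).bddBelow i

theorem natCast_mul_minProb_le (n : ℕ) {k : ℕ} (θ : stdSimplex ℝ (Fin (k + 1)))
    (i : Fin (k + 1)) : n * minProb θ ≤ n * θ i :=
  mul_le_mul_of_nonneg_left (minProb_le θ i) n.cast_nonneg

theorem ellipsoid_mono (n : ℕ) {k : ℕ} (θ : stdSimplex ℝ (Fin (k + 1))) :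
    Monotone (ellipsoid n θ) :=
  fun _ _ hM _ hh => ⟨hh.1, hh.2.1.trans hM, hh.2.2⟩

theorem zero_mem_ellipsoid (n : ℕ) {k : ℕ} (θ : stdSimplex ℝ (Fin (k + 1))) {M : ℝ}
    (hM : 0 ≤ M) : 0 ∈ ellipsoid n θ M := by
  refine ⟨fun _ _ => rfl, by simpa [sigmaSq] using hM, by simp, fun i => ?_⟩
  exact neg_nonpos.2 (mul_nonneg (Real.sqrt_nonneg _) (stdSimplex.zero_le θ i))

theorem densityAt_zero (n : ℕ) {k : ℕ} (θ : stdSimplex ℝ (Fin (k + 1)))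
    (w : (Fin k → ℝ) → ℝ≥0) : densityAt n θ w 0 = w (Fin.tail θ) := by
  simp [densityAt]

theorem IsPriorWithDensity.map_tail_absolutelyContinuous {k : ℕ}
    {W : Measure (stdSimplex ℝ (Fin (k + 1)))} {w : (Fin k → ℝ) → ℝ≥0}
    (hW : IsPriorWithDensity W w) :
    W.map (fun τ : stdSimplex ℝ (Fin (k + 1)) => Fin.tail τ) ≪
      (volume : Measure (Fin k → ℝ)) :=
  hW.2 ▸ withDensity_absolutelyContinuous _ _

variable {θ₀ : PMF ℕ+} {k : ℕ → ℕ} {w : ∀ n, (Fin (k n) → ℝ) → ℝ≥0} {M : ℕ → ℝ}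

theorem TruncationCondition.eventually_one_le (h : TruncationCondition θ₀ k) :
    ∀ᶠ n : ℕ in atTop, ∀ i, 1 ≤ n * truncPmf θ₀ (k n) i := by
  filter_upwards [h.eventually_ge_atTop 1] with n hn i
  exact hn.trans (natCast_mul_minProb_le n _ i)

theorem PriorSmoothness.eventually_half_le (h : PriorSmoothness θ₀ k w M)
    (hM : Tendsto M atTop atTop) :
    ∀ᶠ n in atTop, ∀ g ∈ ellipsoid n (truncPmf θ₀ (k n)) (M n),
      w n (Fin.tail (truncPmf θ₀ (k n))) / 2 ≤ densityAt n (truncPmf θ₀ (k n)) (w n) g := by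
  filter_upwards [h.eventually_le_const ENNReal.one_lt_two, hM.eventually_ge_atTop 0]
    with n hn hM0 g hg
  simp only [iSup_le_iff] at hn
  have hratio := hn 0 (zero_mem_ellipsoid n _ hM0) g hg
  rw [ENNReal.div_le_iff_le_mul (.inr ENNReal.ofNat_ne_top) (.inl ENNReal.coe_ne_top),
    densityAt_zero] at hratio
  rw [← ENNReal.coe_ofNat, ← ENNReal.coe_mul, ENNReal.coe_le_coe] at hratio
  rwa [div_le_iff₀' two_pos]

theorem PriorConcentration.eventually_le (h : PriorConcentration θ₀ k w M)
    (hM : Tendsto M atTop atTop) {ε : ℝ} (hε : 0 < ε) :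
    ∀ᶠ n in atTop, (k n : ℝ) / 2 * Real.log n ≤ ε * M n ∧
      -Real.log (w n (Fin.tail (truncPmf θ₀ (k n)))) ≤ ε * M n := by
  filter_upwards [h.2.bound hε, hM.eventually_ge_atTop 0] with n hn hM0
  rw [Real.norm_of_nonneg hM0] at hn
  have hmax := (le_abs_self _).trans hn
  exact ⟨((le_max_left _ _).trans (le_max_left _ _)).trans hmax, (le_max_right _ _).trans hmax⟩

theorem PriorConcentration.natCast_isLittleO (h : PriorConcentration θ₀ k w M)
    (hM : Tendsto M atTop atTop) : (fun n => (k n : ℝ)) =o[atTop] M := by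
  have hlog : ∀ᶠ n : ℕ in atTop, 2 ≤ Real.log n :=
    (Real.tendsto_log_atTop.comp tendsto_natCast_atTop_atTop).eventually_ge_atTop 2
  refine isLittleO_iff.2 fun ε hε => ?_
  filter_upwards [h.eventually_le hM hε, hlog, hM.eventually_ge_atTop 0] with n hn hlog_n hM0
  rw [Real.norm_natCast, Real.norm_of_nonneg hM0]
  calc (k n : ℝ) = k n / 2 * 2 := by ring
    _ ≤ k n / 2 * Real.log n := by gcongr
    _ ≤ ε * M n := hn.1

theorem eventually_exp_neg_le_prior {W : ∀ n, Measure (stdSimplex ℝ (Fin (k n + 1)))}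
    (hW : ∀ n, IsPriorWithDensity (W n) (w n)) (hM : Tendsto M atTop atTop)
    (h_trunc : TruncationCondition θ₀ k) (h_smooth : PriorSmoothness θ₀ k w M)
    (h_conc : PriorConcentration θ₀ k w M) {ε : ℝ} (hε : 0 < ε) :
    ∀ᶠ n in atTop, ENNReal.ofReal (Real.exp (-(ε * M n))) ≤
      W n {τ | n * chiSq τ (truncPmf θ₀ (k n)) ≤ ε * M n} := by
  have hε6 : 0 < ε / 6 := by positivity
  filter_upwards [h_conc.1, h_conc.eventually_le hM hε6, h_smooth.eventually_half_le hM,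
    h_trunc.eventually_one_le, hM.eventually_ge_atTop 1,
    (hM.const_mul_atTop hε6).eventually_ge_atTop 1, eventually_gt_atTop 0]
    with n hw_pos hlog hhalf hθ hM1 hs hn
  have hball : Real.exp (-(ε * M n)) ≤
      w n (Fin.tail (truncPmf θ₀ (k n))) / 2 * (2 * ((n : ℝ) ^ 2)⁻¹) ^ k n :=
    calc Real.exp (-(ε * M n)) = Real.exp (-(6 * (ε / 6 * M n))) := by ring_nf
      _ ≤ _ := exp_neg_six_mul_le hn (NNReal.coe_pos.2 hw_pos) hs hlog.1 hlog.2
  calc ENNReal.ofReal (Real.exp (-(ε * M n)))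
      ≤ ENNReal.ofReal
          (w n (Fin.tail (truncPmf θ₀ (k n))) / 2 * (2 * ((n : ℝ) ^ 2)⁻¹) ^ k n) :=
        ENNReal.ofReal_le_ofReal hball
    _ = (w n (Fin.tail (truncPmf θ₀ (k n))) / 2 : ℝ≥0) *
          ENNReal.ofReal ((2 * ((n : ℝ) ^ 2)⁻¹) ^ k n) := by
        rw [ENNReal.ofReal_mul (by positivity), ← ENNReal.ofReal_coe_nnreal, NNReal.coe_div,
          NNReal.coe_ofNat]
    _ ≤ W n {τ | n * chiSq τ (truncPmf θ₀ (k n)) ≤ 1} :=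
        mul_ofReal_le_prior (hW n) hθ fun h hh => hhalf h (ellipsoid_mono n _ hM1 hh)
    _ ≤ W n {τ | n * chiSq τ (truncPmf θ₀ (k n)) ≤ ε * M n} :=
        measure_mono fun τ hτ => hτ.out.trans (by linarith)

end Conditions

section Limits

variable {k : ℕ → ℕ} {M : ℕ → ℝ}

theorem eventually_mul_le_of_isBigO {θ : ∀ n, stdSimplex ℝ (Fin (k n + 1))}
    (hM : M =O[atTop] fun n => (n : ℝ) * minProb (θ n)) :
    ∃ c > 0, ∀ᶠ n : ℕ in atTop, ∀ i, c * M n ≤ n * θ n i := by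
  obtain ⟨C, hC, hbound⟩ := hM.exists_pos
  refine ⟨C⁻¹, inv_pos.2 hC, hbound.bound.mono fun n hn i => ?_⟩
  rw [Real.norm_of_nonneg (mul_nonneg n.cast_nonneg (minProb_nonneg _))] at hn
  exact ((inv_mul_le_iff₀ hC).2 ((le_abs_self _).trans hn)).trans (natCast_mul_minProb_le n _ i)

theorem tendsto_ofReal_div_add_ofReal_exp (hM : Tendsto M atTop atTop)
    (hk : (fun n => (k n : ℝ)) =o[atTop] M) :
    Tendsto (fun n => ENNReal.ofReal ((k n + 1) / M n) + ENNReal.ofReal (Real.exp (-(11 * M n))))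
      atTop (𝓝 0) := by
  have hdiv : Tendsto (fun n => (k n + 1) / M n) atTop (𝓝 0) :=
    (hk.add (isLittleO_const_left.2 (.inr (tendsto_norm_atTop_atTop.comp hM))))
      |>.tendsto_div_nhds_zero
  have hexp : Tendsto (fun n => Real.exp (-(11 * M n))) atTop (𝓝 0) :=
    Real.tendsto_exp_neg_atTop_nhds_zero.comp (hM.const_mul_atTop (by norm_num))
  simpa using (ENNReal.tendsto_ofReal hdiv).add (ENNReal.tendsto_ofReal hexp)

end Limits

end PosteriorConcentration

theorem lemma3p6_general {k : ℕ → ℕ} (θ : ∀ n, stdSimplex ℝ (Fin (k n + 1)))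
    (W : ∀ n, Measure (stdSimplex ℝ (Fin (k n + 1)))) [∀ n, IsProbabilityMeasure (W n)]
    (hW : ∀ n, (W n).map (fun τ : stdSimplex ℝ (Fin (k n + 1)) => Fin.tail τ) ≪
      (volume : Measure (Fin (k n) → ℝ)))
    {M : ℕ → ℝ} (hM : Tendsto M atTop atTop)
    (hMθ : M =O[atTop] fun n : ℕ => (n : ℝ) * minProb (θ n))
    (hkM : (fun n => (k n : ℝ)) =o[atTop] M)
    (h_mass : ∀ ε > 0, ∀ᶠ n in atTop, ENNReal.ofReal (Real.exp (-(ε * M n))) ≤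
      W n {τ | fisherForm (θ n) (Fin.tail (deviation n (θ n) τ)) ≤ ε * M n}) :
    (∀ᶠ n in atTop,
      ∫⁻ x, posterior (model n (k n)) (W n) x
          {τ | M n ≤ fisherForm (θ n) (Fin.tail (deviation n (θ n) τ))} ∂sampleLaw n (θ n) =
        ∫⁻ x, posterior (model n (k n)) (W n) x
          {τ | deviation n (θ n) τ ∉ ellipsoid n (θ n) (M n)} ∂sampleLaw n (θ n)) ∧
    Tendsto (fun n => ∫⁻ x, posterior (model n (k n)) (W n) x
        {τ | M n ≤ fisherForm (θ n) (Fin.tail (deviation n (θ n) τ))} ∂sampleLaw n (θ n))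
      atTop (𝓝 0) := by
  obtain ⟨c, hc, hcM⟩ := eventually_mul_le_of_isBigO hMθ
  obtain ⟨ε, hε, hε_M, hε_c⟩ : ∃ ε > 0, 396 * ε ≤ 1 ∧ 44 * ε ≤ c :=
    ⟨min (1 / 396) (c / 44), by positivity, by linarith [min_le_left (1 / 396) (c / 44)],
      by linarith [min_le_right (1 / 396) (c / 44)]⟩
  have hεM : Tendsto (fun n => ε * M n) atTop atTop := hM.const_mul_atTop hε
  have hcell : ∀ᶠ n : ℕ in atTop, 0 < M n ∧ ∀ i, 44 * (ε * M n) ≤ n * θ n i := by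
    filter_upwards [hcM, hM.eventually_gt_atTop 0] with n hn hM0
    exact ⟨hM0, fun i => by nlinarith [hn i]⟩
  simp only [fisherForm_tail_deviation] at h_mass ⊢
  constructor
  · filter_upwards [h_mass ε hε, hcell] with n hmass ⟨hM0, hθ⟩
    have ht : 0 < ε * M n := mul_pos hε hM0
    have hθ0 : ∀ i, 0 < θ n i := fun i => pos_of_le_natCast_mul (by positivity) (hθ i)
    simp only [deviation_mem_ellipsoid_iff hθ0, not_le]
    exact lintegral_posterior_chiSq_ge_eq_gt ht (fun i => by linarith [hθ i]) hM0 (hW n)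
      ((ENNReal.ofReal_pos.2 (Real.exp_pos _)).trans_le hmass).ne' _
  · refine tendsto_of_tendsto_of_tendsto_of_le_of_le' tendsto_const_nhds
      (tendsto_ofReal_div_add_ofReal_exp hεM (hkM.const_mul_right hε.ne'))
      (.of_forall fun _ => zero_le) ?_
    filter_upwards [h_mass ε hε, hcell] with n hmass ⟨hM0, hθ⟩
    exact lintegral_posterior_chiSq_ge_le (mul_pos hε hM0) hθ (by nlinarith) hmass

theorem lemma3p6 (θ₀ : PMF ℕ+) (k : ℕ → ℕ) (hk : ∀ n, 1 ≤ k n) (hk_mono : Monotone k)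
    (W : ∀ n, Measure (stdSimplex ℝ (Fin (k n + 1)))) [∀ n, IsProbabilityMeasure (W n)]
    (w : ∀ n, (Fin (k n) → ℝ) → ℝ≥0) (hW : ∀ n, IsPriorWithDensity (W n) (w n))
    (M : ℕ → ℝ) (hM_mono : Monotone M) (hM : Tendsto M atTop atTop)
    (h_trunc : TruncationCondition θ₀ k)
    (h_smooth : PriorSmoothness θ₀ k w M)
    (h_conc : PriorConcentration θ₀ k w M)
    (hM_small : M =o[atTop] fun n : ℕ => (n : ℝ) * minProb (truncPmf θ₀ (k n))) :
    (∀ᶠ n in atTop,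
      expectedPosterior θ₀ n (k n) (W n)
          {τ | M n ≤ fisherForm (truncPmf θ₀ (k n))
            (Fin.tail (deviation n (truncPmf θ₀ (k n)) τ))} =
        expectedPosterior θ₀ n (k n) (W n)
          {τ | deviation n (truncPmf θ₀ (k n)) τ ∉ ellipsoid n (truncPmf θ₀ (k n)) (M n)}) ∧
    Tendsto (fun n : ℕ => expectedPosterior θ₀ n (k n) (W n)
        {τ | M n ≤ fisherForm (truncPmf θ₀ (k n))
          (Fin.tail (deviation n (truncPmf θ₀ (k n)) τ))})
      atTop (𝓝 0) := by
  refine lemma3p6_general (fun n => truncPmf θ₀ (k n)) W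
    (fun n => (hW n).map_tail_absolutelyContinuous) hM hM_small.isBigO
    (h_conc.natCast_isLittleO hM) fun ε hε => ?_
  simpa only [fisherForm_tail_deviation] using
    eventually_exp_neg_le_prior hW hM h_trunc h_smooth h_conc hε
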